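/- Call a continuous function $f\colon\mathbb{R}\to\mathbb{C}$ almost periodic in the sense of Bohr if, for every $\varepsilon>0$, the set $\{t\in\mathbb{R} : \sup_{x\in\mathbb{R}}|f(x)-f(x-t)|<\varepsilon\}$ is relatively dense in $\mathbb{R}$, that is, there is $L>0$ such that every interval $[a,a+L]$ with $a\in\mathbb{R}$ contains an element of it. Let $\alpha\in\mathbb{R}$ with $|\alpha|>1$, and let $f\colon\mathbb{R}\to\mathbb{C}$ be almost periodic in the sense of Bohr. Then the mean \[ M(f)=\lim_{T\to\infty}\frac{1}{2T}\int_{a-T}^{a+T} f(x)\,\mathrm{d}x \] exists for every $a\in\mathbb{R}$, is independent of $a$, with convergence uniform in $a$, and for Lebesgue-almost every $x\in\mathbb{R}$ one has \[ \lim_{N\to\infty}\frac1N\sum_{n=0}^{N-1} f(\alpha^n x)=M(f). \] -/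

import Mathlib

open Filter Topology MeasureTheory

/-- A set `S` of reals is relatively dense: every interval of some fixed length meets it. -/
def IsRelativelyDense (S : Set ℝ) : Prop :=
  ∃ L : ℝ, 0 < L ∧ ∀ a : ℝ, ∃ t ∈ S, t ∈ Set.Icc a (a + L)

/-- The `ε`-almost periods of `f`: all `t` with `‖f - T_t f‖_∞ < ε`, where `(T_t f)(x) = f(x - t)`.
The supremum is taken in `[0, ∞]`. -/
def almostPeriods (f : ℝ → ℂ) (ε : ℝ) : Set ℝ :=
  {t : ℝ | (⨆ x : ℝ, ‖f x - f (x - t)‖ₑ) < ENNReal.ofReal ε}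

/-- Almost periodicity in the sense of Bohr. -/
def IsBohrAlmostPeriodic (f : ℝ → ℂ) : Prop :=
  Continuous f ∧ ∀ ε : ℝ, 0 < ε → IsRelativelyDense (almostPeriods f ε)

/-- `M` is the mean of `f`: `(1 / 2T) ∫_{a-T}^{a+T} f` tends to `M` as `T → ∞`,
uniformly in `a : ℝ`. -/
def HasMean (f : ℝ → ℂ) (M : ℂ) : Prop :=
  TendstoUniformly (fun T a : ℝ => (1 / (2 * T)) • ∫ x in (a - T)..(a + T), f x)
    (fun _ => M) atTop

/-!
Let `A_T f` be the average of `f` over an interval of length `T`. Shifting by almost periods shows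
that `A_T f` hardly depends on the position of the interval once `T` is large; together with
`A_S A_T f = A_T A_S f` this makes the averages Cauchy, so the mean `M` exists uniformly.

For the averages along `c n * x`, approximate `f - M` uniformly by functions `g` with bounded
derivative and bounded primitive: first subtract a long moving average, which is close to zero,
then take a short one. Integration by parts over a fixed interval bounds the correlation of
`g (c m * x)` and `g (c n * x)` by a multiple of `|c m| / |c n|`, which decays geometrically in
`n - m`. Hence the averages of `N` terms have mean square `O(1 / N)`; they converge to zero almost
everywhere along `N = k ^ 2`, and by boundedness along all `N`.
-/

open scoped RealInnerProductSpace

section MovingAverage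

variable {E : Type*} [NormedAddCommGroup E] [NormedSpace ℝ E]

/-- The moving average of `f`: its value at `x` is the average of `f` over `[x, x + s]`. It serves
both to express uniform means (`s → ∞`) and to regularize functions (`s → 0`). -/
noncomputable def movingAverage (s : ℝ) (f : ℝ → E) (x : ℝ) : E :=
  ⨍ t in x..x + s, f t

theorem movingAverage_eq_smul_integral (s : ℝ) (f : ℝ → E) (x : ℝ) :
    movingAverage s f x = s⁻¹ • ∫ t in x..x + s, f t := by
  rw [movingAverage, interval_average_eq, add_sub_cancel_left]

theorem movingAverage_eq_smul_integral_add (s : ℝ) (f : ℝ → E) (x : ℝ) :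
    movingAverage s f x = s⁻¹ • ∫ t in 0..s, f (x + t) := by
  rw [movingAverage_eq_smul_integral, intervalIntegral.integral_comp_add_left, add_zero]

theorem movingAverage_sub {f g : ℝ → E} (hf : Continuous f) (hg : Continuous g) (s x : ℝ) :
    movingAverage s (fun y => f y - g y) x = movingAverage s f x - movingAverage s g x := by
  simp only [movingAverage_eq_smul_integral]
  rw [intervalIntegral.integral_sub (hf.intervalIntegrable _ _) (hg.intervalIntegrable _ _),
    smul_sub]

theorem movingAverage_comp_sub_right (s : ℝ) (f : ℝ → E) (t x : ℝ) :
    movingAverage s (fun y => f (y - t)) x = movingAverage s f (x - t) := by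
  simp only [movingAverage_eq_smul_integral_add, sub_add_eq_add_sub]

theorem movingAverage_comm {f : ℝ → E} (hf : Continuous f) (s t x : ℝ) :
    movingAverage s (movingAverage t f) x = movingAverage t (movingAverage s f) x := by
  simp only [movingAverage_eq_smul_integral_add, intervalIntegral.integral_smul]
  rw [smul_comm, intervalIntegral_intervalIntegral_swap]
  · simp only [add_right_comm]
  · have hcont : Continuous (Function.uncurry fun u v => f (x + u + v)) := by fun_prop
    exact (hcont.continuousOn.integrableOn_compact
      (isCompact_uIcc.prod isCompact_uIcc)).mono_set
        (Set.prod_mono Set.uIoc_subset_uIcc Set.uIoc_subset_uIcc)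

theorem norm_inv_smul_sub_le {s : ℝ} (hs : 0 < s) {u v : E} {B : ℝ} (hu : ‖u‖ ≤ B)
    (hv : ‖v‖ ≤ B) : ‖s⁻¹ • (u - v)‖ ≤ 2 * B / s := by
  rw [norm_smul, norm_inv, Real.norm_of_nonneg hs.le, inv_mul_eq_div]
  gcongr
  linarith [norm_sub_le u v]

variable [CompleteSpace E]

theorem norm_movingAverage_sub_le {f : ℝ → E} (hf : Continuous f) {s x C : ℝ} (hs : 0 < s) {c : E}
    (h : ∀ t ∈ Set.Icc x (x + s), ‖f t - c‖ ≤ C) : ‖movingAverage s f x - c‖ ≤ C := by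
  have hx : x < x + s := by linarith
  rw [← mem_closedBall_iff_norm, movingAverage, Set.uIoc_of_le hx.le]
  refine (convex_closedBall c C).set_average_mem Metric.isClosed_closedBall (by simpa using hs)
    (by simp) ?_ hf.integrableOn_Ioc
  filter_upwards [ae_restrict_mem measurableSet_Ioc] with t ht
  exact mem_closedBall_iff_norm.2 (h t (Set.Ioc_subset_Icc_self ht))

theorem norm_movingAverage_le {f : ℝ → E} (hf : Continuous f) {s C : ℝ} (hs : 0 < s)
    (hC : ∀ t, ‖f t‖ ≤ C) (x : ℝ) : ‖movingAverage s f x‖ ≤ C := by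
  simpa only [sub_zero] using norm_movingAverage_sub_le hf hs (x := x) (c := 0) (C := C)
    (by simpa only [sub_zero] using fun t _ => hC t)

theorem movingAverage_sub_const {f : ℝ → E} (hf : Continuous f) {s : ℝ} (hs : 0 < s) (c : E)
    (x : ℝ) : movingAverage s (fun y => f y - c) x = movingAverage s f x - c := by
  rw [movingAverage_sub hf continuous_const, movingAverage_eq_smul_integral s fun _ => c,
    intervalIntegral.integral_const, add_sub_cancel_left, inv_smul_smul₀ hs.ne']

theorem hasDerivAt_movingAverage {f : ℝ → E} (hf : Continuous f) (s x : ℝ) :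
    HasDerivAt (movingAverage s f) (s⁻¹ • (f (x + s) - f x)) x := by
  have hF := hf.integral_hasStrictDerivAt 0
  have h := (((hF (x + s)).hasDerivAt.comp_add_const x s).sub (hF x).hasDerivAt).const_smul s⁻¹
  refine h.congr_of_eventuallyEq (Eventually.of_forall fun y => ?_)
  simp [movingAverage_eq_smul_integral, intervalIntegral.integral_interval_sub_left
    (hf.intervalIntegrable _ _) (hf.intervalIntegrable _ _)]

theorem continuous_movingAverage {f : ℝ → E} (hf : Continuous f) (s : ℝ) :
    Continuous (movingAverage s f) :=
  continuous_iff_continuousAt.2 fun x => (hasDerivAt_movingAverage hf s x).continuousAt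

theorem hasDerivAt_movingAverage_of_hasDerivAt {F f : ℝ → E} (hF : ∀ x, HasDerivAt F (f x) x)
    (hf : Continuous f) (s x : ℝ) :
    HasDerivAt (movingAverage s F) (movingAverage s f x) x := by
  have hFc : Continuous F := continuous_iff_continuousAt.2 fun x => (hF x).continuousAt
  rw [movingAverage_eq_smul_integral,
    intervalIntegral.integral_eq_sub_of_hasDerivAt (fun y _ => hF y) (hf.intervalIntegrable _ _)]
  exact hasDerivAt_movingAverage hFc s x

theorem norm_movingAverage_sub_movingAverage_le {f : ℝ → E} (hf : Continuous f) {s B : ℝ}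
    (hs : 0 < s) (hB : ∀ x, ‖f x‖ ≤ B) (x y : ℝ) :
    ‖movingAverage s f x - movingAverage s f y‖ ≤ 2 * B / s * |x - y| :=
  convex_univ.norm_image_sub_le_of_norm_hasDerivWithin_le
    (fun z _ => (hasDerivAt_movingAverage hf s z).hasDerivWithinAt)
    (fun _ _ => norm_inv_smul_sub_le hs (hB _) (hB _)) (Set.mem_univ y) (Set.mem_univ x)

theorem exists_tendstoUniformly_movingAverage {f : ℝ → E} (hf : Continuous f)
    (h : TendstoUniformly (fun T x => movingAverage T f x - movingAverage T f 0) 0 atTop) :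
    ∃ M, TendstoUniformly (fun T => movingAverage T f) (fun _ => M) atTop := by
  -- The average over `[0, S]` of the averages of length `T` is close to the average over `[0, T]`,
  -- and by `movingAverage_comm` it does not change when `S` and `T` are swapped.
  have hcauchy : CauchySeq fun T => movingAverage T f 0 := by
    rw [Metric.cauchySeq_iff']
    intro ε hε
    have hsmall := Metric.tendstoUniformly_iff.1 h (ε / 3) (by positivity)
    obtain ⟨T₀, hT₀⟩ := eventually_atTop.1 (hsmall.and (eventually_gt_atTop 0))
    have hdouble : ∀ S ≥ T₀, ∀ T ≥ T₀,
        ‖movingAverage S (movingAverage T f) 0 - movingAverage T f 0‖ ≤ ε / 3 := fun S hS T hT =>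
      norm_movingAverage_sub_le (continuous_movingAverage hf T) (hT₀ S hS).2 fun x _ => by
        simpa [dist_eq_norm'] using ((hT₀ T hT).1 x).le
    refine ⟨T₀, fun S hS => ?_⟩
    rw [dist_eq_norm]
    have hS₀ := hdouble T₀ le_rfl S hS
    have h₀S := hdouble S hS T₀ le_rfl
    rw [movingAverage_comm hf, norm_sub_rev] at hS₀
    linarith [norm_sub_le_norm_sub_add_norm_sub (movingAverage S f 0)
      (movingAverage S (movingAverage T₀ f) 0) (movingAverage T₀ f 0)]
  obtain ⟨M, hM⟩ := cauchySeq_tendsto_of_complete hcauchy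
  refine ⟨M, ?_⟩
  simpa [Pi.add_def, Pi.sub_def] using h.add (hM.tendstoUniformly_const (α := ℝ))

end MovingAverage

theorem hasMean_of_tendstoUniformly_movingAverage {f : ℝ → ℂ} {M : ℂ}
    (h : TendstoUniformly (fun T => movingAverage T f) (fun _ => M) atTop) : HasMean f M := by
  rw [HasMean, Metric.tendstoUniformly_iff]
  intro ε hε
  have htwo : Tendsto (fun T : ℝ => 2 * T) atTop atTop := tendsto_id.const_mul_atTop two_pos
  filter_upwards [htwo.eventually (Metric.tendstoUniformly_iff.1 h ε hε)] with T hT a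
  have := hT (a - T)
  rwa [movingAverage_eq_smul_integral, show a - T + 2 * T = a + T by ring, ← one_div] at this

theorem norm_sub_lt_of_mem_almostPeriods {f : ℝ → ℂ} {ε t : ℝ} (ht : t ∈ almostPeriods f ε)
    (x : ℝ) : ‖f x - f (x - t)‖ < ε := by
  have h : ‖f x - f (x - t)‖ₑ < ENNReal.ofReal ε :=
    (le_iSup (fun x => ‖f x - f (x - t)‖ₑ) x).trans_lt ht
  rw [← ofReal_norm] at h
  exact (ENNReal.ofReal_lt_ofReal_iff_of_nonneg (norm_nonneg _)).1 h

namespace IsBohrAlmostPeriodic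

variable {f : ℝ → ℂ}

theorem exists_almostPeriod_sub_mem_Icc (hf : IsBohrAlmostPeriodic f) {ε : ℝ} (hε : 0 < ε) :
    ∃ L : ℝ, ∀ a : ℝ, ∃ t : ℝ, a - t ∈ Set.Icc 0 L ∧ ∀ x, ‖f x - f (x - t)‖ < ε := by
  obtain ⟨L, -, h⟩ := hf.2 ε hε
  refine ⟨L, fun a => ?_⟩
  obtain ⟨t, ht, hat, hta⟩ := h (a - L)
  exact ⟨t, ⟨by linarith, by linarith⟩, norm_sub_lt_of_mem_almostPeriods ht⟩

theorem exists_norm_le (hf : IsBohrAlmostPeriodic f) : ∃ B : ℝ, ∀ x, ‖f x‖ ≤ B := by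
  obtain ⟨L, h⟩ := hf.exists_almostPeriod_sub_mem_Icc one_pos
  obtain ⟨C, hC⟩ := (isCompact_Icc (a := (0 : ℝ)) (b := L)).exists_bound_of_continuousOn
    hf.1.continuousOn
  refine ⟨1 + C, fun x => ?_⟩
  obtain ⟨t, hxt, ht⟩ := h x
  linarith [norm_le_norm_sub_add (f x) (f (x - t)), ht x, hC _ hxt]

theorem uniformContinuous (hf : IsBohrAlmostPeriodic f) : UniformContinuous f := by
  rw [Metric.uniformContinuous_iff]
  intro ε hε
  obtain ⟨L, h⟩ := hf.exists_almostPeriod_sub_mem_Icc (ε := ε / 3) (by positivity)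
  have hcompact := (isCompact_Icc (a := (-1 : ℝ)) (b := L + 1)).uniformContinuousOn_of_continuous
    hf.1.continuousOn
  obtain ⟨δ, hδ, hclose⟩ := Metric.uniformContinuousOn_iff.1 hcompact (ε / 3) (by positivity)
  refine ⟨min δ 1, lt_min hδ one_pos, fun x y hxy => ?_⟩
  obtain ⟨hxyδ, hxy1⟩ := lt_min_iff.1 hxy
  obtain ⟨t, ⟨hxt, hxtL⟩, ht⟩ := h x
  rw [Real.dist_eq, abs_lt] at hxy1
  have hshift : dist (f (x - t)) (f (y - t)) < ε / 3 :=
    hclose _ ⟨by linarith, by linarith⟩ _ ⟨by linarith, by linarith⟩ (by simpa using hxyδ)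
  have hx : dist (f x) (f (x - t)) < ε / 3 := by simpa [dist_eq_norm] using ht x
  have hy : dist (f (y - t)) (f y) < ε / 3 := by simpa [dist_eq_norm'] using ht y
  linarith [dist_triangle4 (f x) (f (x - t)) (f (y - t)) (f y)]

theorem tendstoUniformly_movingAverage_sub (hf : IsBohrAlmostPeriodic f) :
    TendstoUniformly (fun T x => movingAverage T f x - movingAverage T f 0) 0 atTop := by
  rw [Metric.tendstoUniformly_iff]
  intro ε hε
  obtain ⟨B, hB⟩ := hf.exists_norm_le
  obtain ⟨L, h⟩ := hf.exists_almostPeriod_sub_mem_Icc (ε := ε / 2) (by positivity)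
  have hB0 : 0 ≤ B := (norm_nonneg _).trans (hB 0)
  have hsmall : ∀ᶠ T : ℝ in atTop, 2 * B / T * L < ε / 2 := by
    have hlim : Tendsto (fun T : ℝ => 2 * B / T * L) atTop (𝓝 0) := by
      simpa using (tendsto_id.const_div_atTop (2 * B)).mul_const L
    exact hlim.eventually (gt_mem_nhds (by positivity))
  filter_upwards [hsmall, eventually_gt_atTop 0] with T hTL hT a
  obtain ⟨t, hat, ht⟩ := h a
  have hperiod : ‖movingAverage T f a - movingAverage T f (a - t)‖ ≤ ε / 2 := by
    have hft : Continuous fun x => f (x - t) := hf.1.comp (continuous_sub_right t)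
    rw [← movingAverage_comp_sub_right, ← movingAverage_sub hf.1 hft]
    exact norm_movingAverage_le (hf.1.sub hft) hT (fun x => (ht x).le) a
  have hcompact : ‖movingAverage T f (a - t) - movingAverage T f 0‖ ≤ 2 * B / T * L := by
    refine (norm_movingAverage_sub_movingAverage_le hf.1 hT hB _ _).trans ?_
    rw [sub_zero, abs_of_nonneg hat.1]
    gcongr
    exact hat.2
  rw [dist_eq_norm, Pi.zero_apply, zero_sub, norm_neg]
  linarith [norm_sub_le_norm_sub_add_norm_sub (movingAverage T f a) (movingAverage T f (a - t))
    (movingAverage T f 0)]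

end IsBohrAlmostPeriodic

theorem ae_tendsto_zero_of_summable_integral_norm {E : Type*} [NormedAddCommGroup E] {Ω : Type*}
    [MeasurableSpace Ω] {μ : Measure Ω} {F : ℕ → Ω → E} (hF : ∀ k, Integrable (F k) μ)
    (hsum : Summable fun k => ∫ ω, ‖F k ω‖ ∂μ) :
    ∀ᵐ ω ∂μ, Tendsto (fun k => F k ω) atTop (𝓝 0) := by
  have hmeas : ∀ k, AEMeasurable (fun ω => ‖F k ω‖ₑ) μ := fun k => (hF k).1.enorm
  have hfinite : ∫⁻ ω, ∑' k, ‖F k ω‖ₑ ∂μ ≠ ⊤ := by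
    rw [lintegral_tsum hmeas]
    simpa only [← ofReal_integral_norm_eq_lintegral_enorm (hF _)] using hsum.tsum_ofReal_ne_top
  filter_upwards [ae_lt_top' (AEMeasurable.tsum hmeas) hfinite] with ω hω
  rw [tendsto_zero_iff_enorm_tendsto_zero]
  exact ENNReal.tendsto_atTop_zero_of_tsum_ne_top hω.ne

section CesaroMean

variable {E : Type*} [NormedAddCommGroup E] [NormedSpace ℝ E]

/-- The average of the first `N` terms of the sequence `u`, with value `0` for `N = 0`. -/
noncomputable def cesaroMean (u : ℕ → E) (N : ℕ) : E :=
  (N : ℝ)⁻¹ • ∑ n ∈ Finset.range N, u n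

theorem cesaroMean_sub (u v : ℕ → E) (N : ℕ) :
    cesaroMean (fun n => u n - v n) N = cesaroMean u N - cesaroMean v N := by
  rw [cesaroMean, Finset.sum_sub_distrib, smul_sub, cesaroMean, cesaroMean]

theorem norm_cesaroMean_le {u : ℕ → E} {B : ℝ} (hB : ∀ n, ‖u n‖ ≤ B) (N : ℕ) :
    ‖cesaroMean u N‖ ≤ B := by
  rcases N.eq_zero_or_pos with rfl | hN
  · simpa [cesaroMean] using (norm_nonneg _).trans (hB 0)
  have hN' : (0 : ℝ) < N := by exact_mod_cast hN
  rw [cesaroMean, norm_smul, norm_inv, RCLike.norm_natCast, inv_mul_le_iff₀ hN']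
  simpa using norm_sum_le_of_le (Finset.range N) fun n _ => hB n

theorem norm_cesaroMean_le_add {u : ℕ → E} {B : ℝ} (hB : ∀ n, ‖u n‖ ≤ B) {M N : ℕ} (hM : 0 < M)
    (hMN : M ≤ N) : ‖cesaroMean u N‖ ≤ ‖cesaroMean u M‖ + (N - M) / M * B := by
  have : (0 : ℝ) < M := by exact_mod_cast hM
  have hMN' : (M : ℝ) ≤ N := by exact_mod_cast hMN
  have htail : ‖∑ n ∈ Finset.Ico M N, u n‖ ≤ (N - M) * B := by
    simpa [hMN] using norm_sum_le_of_le (Finset.Ico M N) fun n _ => hB n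
  have hsum : ‖∑ n ∈ Finset.range N, u n‖ ≤ ‖∑ n ∈ Finset.range M, u n‖ + (N - M) * B := by
    rw [← Finset.sum_range_add_sum_Ico u hMN]
    exact (norm_add_le _ _).trans (by gcongr)
  calc ‖cesaroMean u N‖ = (N : ℝ)⁻¹ * ‖∑ n ∈ Finset.range N, u n‖ := by
        rw [cesaroMean, norm_smul, norm_inv, RCLike.norm_natCast]
    _ ≤ (M : ℝ)⁻¹ * (‖∑ n ∈ Finset.range M, u n‖ + (N - M) * B) := by gcongr
    _ = ‖cesaroMean u M‖ + (N - M) / M * B := by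
        rw [cesaroMean, norm_smul, norm_inv, RCLike.norm_natCast]
        ring

theorem tendsto_cesaroMean_zero_of_sq {u : ℕ → E} {B : ℝ} (hB : ∀ n, ‖u n‖ ≤ B)
    (h : Tendsto (fun k => cesaroMean u (k ^ 2)) atTop (𝓝 0)) :
    Tendsto (cesaroMean u) atTop (𝓝 0) := by
  have hB0 : 0 ≤ B := (norm_nonneg _).trans (hB 0)
  have hbound : Tendsto (fun k : ℕ => ‖cesaroMean u (k ^ 2)‖ + 2 * B / k) atTop (𝓝 0) := by
    simpa using h.norm.add (tendsto_const_div_atTop_nhds_zero_nat (2 * B))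
  have hsqrt : Tendsto Nat.sqrt atTop atTop :=
    tendsto_atTop_atTop.2 fun b => ⟨b ^ 2, fun a ha => Nat.le_sqrt'.2 ha⟩
  refine squeeze_zero_norm' ?_ (hbound.comp hsqrt)
  filter_upwards [eventually_gt_atTop 0] with N hN
  rw [Function.comp_apply]
  set k := N.sqrt
  have hk : 0 < k := Nat.sqrt_pos.2 hN
  have hgap : (N : ℝ) - k ^ 2 ≤ 2 * k := by
    have : N ≤ k ^ 2 + 2 * k := by linarith [N.sqrt_le_add, sq k]
    rw [sub_le_iff_le_add']
    exact_mod_cast this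
  calc ‖cesaroMean u N‖ ≤ ‖cesaroMean u (k ^ 2)‖ + (N - k ^ 2) / k ^ 2 * B := by
        simpa only [Nat.cast_pow] using norm_cesaroMean_le_add hB (pow_pos hk 2) N.sqrt_le'
    _ ≤ ‖cesaroMean u (k ^ 2)‖ + 2 * k / k ^ 2 * B := by gcongr
    _ = ‖cesaroMean u (k ^ 2)‖ + 2 * B / k := by field_simp

variable {Ω : Type*} [MeasurableSpace Ω] {μ : Measure Ω}

theorem ae_tendsto_cesaroMean_zero_of_approx {X : ℕ → Ω → E}
    (h : ∀ ε > 0, ∃ Y : ℕ → Ω → E, (∀ n ω, ‖X n ω - Y n ω‖ ≤ ε) ∧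
      ∀ᵐ ω ∂μ, Tendsto (cesaroMean fun n => Y n ω) atTop (𝓝 0)) :
    ∀ᵐ ω ∂μ, Tendsto (cesaroMean fun n => X n ω) atTop (𝓝 0) := by
  choose Y hXY hY using fun j : ℕ => h (1 / (j + 1)) (by positivity)
  filter_upwards [ae_all_iff.2 hY] with ω hω
  rw [Metric.tendsto_nhds]
  intro ε hε
  obtain ⟨j, hj⟩ := exists_nat_one_div_lt (half_pos hε)
  filter_upwards [Metric.tendsto_nhds.1 (hω j) (ε / 2) (half_pos hε)] with N hN
  have hdiff := norm_cesaroMean_le (fun n => hXY j n ω) N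
  rw [cesaroMean_sub] at hdiff
  rw [dist_zero_right] at hN ⊢
  linarith [norm_le_norm_sub_add (cesaroMean (fun n => X n ω) N) (cesaroMean (fun n => Y j n ω) N)]

theorem ae_tendsto_cesaroMean_zero_of_integral_norm_sq_le {X : ℕ → Ω → E} {B C : ℝ}
    (hB : ∀ n ω, ‖X n ω‖ ≤ B)
    (hint : ∀ N, Integrable (fun ω => ‖∑ n ∈ Finset.range N, X n ω‖ ^ 2) μ)
    (hC : ∀ N : ℕ, ∫ ω, ‖∑ n ∈ Finset.range N, X n ω‖ ^ 2 ∂μ ≤ C * N) :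
    ∀ᵐ ω ∂μ, Tendsto (cesaroMean fun n => X n ω) atTop (𝓝 0) := by
  have hsq : ∀ k ω, ‖cesaroMean (fun n => X n ω) (k ^ 2)‖ ^ 2 =
      ((k : ℝ) ^ 4)⁻¹ * ‖∑ n ∈ Finset.range (k ^ 2), X n ω‖ ^ 2 := fun k ω => by
    rw [cesaroMean, norm_smul, norm_inv, RCLike.norm_natCast, mul_pow]
    push_cast
    ring
  have hbound : ∀ k : ℕ, ∫ ω, ‖cesaroMean (fun n => X n ω) (k ^ 2)‖ ^ 2 ∂μ ≤
      C * ((k : ℝ) ^ 2)⁻¹ := fun k => by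
    simp only [hsq]
    rw [integral_const_mul]
    calc _ ≤ ((k : ℝ) ^ 4)⁻¹ * (C * (k ^ 2 : ℕ)) := by gcongr; exact hC _
      _ = C * ((k : ℝ) ^ 2)⁻¹ := by
        rcases eq_or_ne (k : ℝ) 0 with hk | hk
        · simp [hk]
        · push_cast
          field_simp
  have hsum : Summable fun k : ℕ => ∫ ω, ‖‖cesaroMean (fun n => X n ω) (k ^ 2)‖ ^ 2‖ ∂μ := by
    simp only [norm_pow, norm_norm]
    exact ((Real.summable_nat_pow_inv.2 one_lt_two).mul_left C).of_nonneg_of_le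
      (fun k => integral_nonneg fun ω => sq_nonneg _) hbound
  have hsqint : ∀ k, Integrable (fun ω => ‖cesaroMean (fun n => X n ω) (k ^ 2)‖ ^ 2) μ :=
    fun k => by simpa only [hsq] using (hint (k ^ 2)).const_mul _
  filter_upwards [ae_tendsto_zero_of_summable_integral_norm hsqint hsum] with ω hω
  refine tendsto_cesaroMean_zero_of_sq (fun n => hB n ω) (tendsto_zero_iff_norm_tendsto_zero.2 ?_)
  simpa using hω.sqrt

end CesaroMean

section Correlation

variable {E : Type*} [NormedAddCommGroup E] [InnerProductSpace ℝ E]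
  {Ω : Type*} [MeasurableSpace Ω] {μ : Measure Ω} {X : ℕ → Ω → E}

theorem integrable_norm_sum_sq (hint : ∀ m n, Integrable (fun ω => ⟪X m ω, X n ω⟫) μ)
    (s : Finset ℕ) : Integrable (fun ω => ‖∑ n ∈ s, X n ω‖ ^ 2) μ := by
  simp only [← real_inner_self_eq_norm_sq, sum_inner, inner_sum]
  exact integrable_finsetSum _ fun m _ => integrable_finsetSum _ fun n _ => hint n m

theorem integral_norm_sum_sq_le_of_correlation_le
    (hint : ∀ m n, Integrable (fun ω => ⟪X m ω, X n ω⟫) μ) {r : ℕ → ℝ} (hr : Summable r)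
    (hcorr : ∀ m n, m ≤ n → |∫ ω, ⟪X m ω, X n ω⟫ ∂μ| ≤ r (n - m)) (N : ℕ) :
    ∫ ω, ‖∑ n ∈ Finset.range N, X n ω‖ ^ 2 ∂μ ≤ 2 * (∑' k, r k) * N := by
  have hr0 : ∀ k, 0 ≤ r k := fun k => (abs_nonneg _).trans (hcorr 0 k k.zero_le)
  induction N with
  | zero => simp
  | succ N ih =>
    have hsq : Integrable (fun ω => ‖∑ n ∈ Finset.range N, X n ω‖ ^ 2) μ :=
      integrable_norm_sum_sq hint _
    have hcross : Integrable (fun ω => 2 * ∑ m ∈ Finset.range N, ⟪X m ω, X N ω⟫) μ :=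
      (integrable_finsetSum _ fun m _ => hint m N).const_mul 2
    have hsqcross : Integrable (fun ω => ‖∑ n ∈ Finset.range N, X n ω‖ ^ 2 +
        2 * ∑ m ∈ Finset.range N, ⟪X m ω, X N ω⟫) μ := hsq.add hcross
    have hexpand : ∀ ω, ‖∑ n ∈ Finset.range (N + 1), X n ω‖ ^ 2 =
        ‖∑ n ∈ Finset.range N, X n ω‖ ^ 2 + 2 * ∑ m ∈ Finset.range N, ⟪X m ω, X N ω⟫ +
          ⟪X N ω, X N ω⟫ := fun ω => by
      rw [Finset.sum_range_succ, norm_add_sq_real, sum_inner, real_inner_self_eq_norm_sq]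
    have hrow : ∑ m ∈ Finset.range (N + 1), ∫ ω, ⟪X m ω, X N ω⟫ ∂μ ≤ ∑' k, r k :=
      calc _ ≤ ∑ m ∈ Finset.range (N + 1), r (N - m) := Finset.sum_le_sum fun m hm =>
            (le_abs_self _).trans (hcorr m N (Finset.mem_range_succ_iff.1 hm))
        _ = ∑ k ∈ Finset.range (N + 1), r k := Finset.sum_flip r
        _ ≤ ∑' k, r k := hr.sum_le_tsum _ fun k _ => hr0 k
    have hdiag : 0 ≤ ∫ ω, ⟪X N ω, X N ω⟫ ∂μ := integral_nonneg fun ω => real_inner_self_nonneg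
    simp only [hexpand]
    rw [integral_add hsqcross (hint N N), integral_add hsq hcross, integral_const_mul,
      integral_finsetSum _ fun m _ => hint m N]
    rw [Finset.sum_range_succ] at hrow
    push_cast
    linarith

theorem ae_tendsto_cesaroMean_zero_of_correlation_le {B : ℝ} (hB : ∀ n ω, ‖X n ω‖ ≤ B)
    (hint : ∀ m n, Integrable (fun ω => ⟪X m ω, X n ω⟫) μ) {r : ℕ → ℝ} (hr : Summable r)
    (hcorr : ∀ m n, m ≤ n → |∫ ω, ⟪X m ω, X n ω⟫ ∂μ| ≤ r (n - m)) :
    ∀ᵐ ω ∂μ, Tendsto (cesaroMean fun n => X n ω) atTop (𝓝 0) :=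
  ae_tendsto_cesaroMean_zero_of_integral_norm_sq_le hB
    (fun N => integrable_norm_sum_sq hint (Finset.range N))
    (integral_norm_sum_sq_le_of_correlation_le hint hr hcorr)

end Correlation

section RegularApproximation

variable {E : Type*} [NormedAddCommGroup E] [NormedSpace ℝ E]

/-- The regular functions of the argument: bounded `C¹` functions whose derivative and primitives
are bounded. -/
structure HasBoundedDerivAndPrimitive (g : ℝ → E) : Prop where
  contDiff : ContDiff ℝ 1 g
  exists_norm_le : ∃ B, ∀ x, ‖g x‖ ≤ B
  exists_norm_deriv_le : ∃ D, ∀ x, ‖deriv g x‖ ≤ D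
  exists_primitive : ∃ G : ℝ → E, (∀ x, HasDerivAt G (g x) x) ∧ ∃ A, ∀ x, ‖G x‖ ≤ A

variable [CompleteSpace E] {f : ℝ → E} {B : ℝ}

theorem exists_bounded_primitive_sub_movingAverage (hf : Continuous f) (hB : ∀ x, ‖f x‖ ≤ B)
    {L : ℝ} (hL : 0 < L) :
    ∃ K : ℝ → E, (∀ x, HasDerivAt K (f x - movingAverage L f x) x) ∧ ∀ x, ‖K x‖ ≤ B * L := by
  set F : ℝ → E := fun x => ∫ t in 0..x, f t
  have hF : ∀ x, HasDerivAt F (f x) x := fun x => (hf.integral_hasStrictDerivAt 0 x).hasDerivAt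
  have hFc : Continuous F := continuous_iff_continuousAt.2 fun x => (hF x).continuousAt
  have hB0 : 0 ≤ B := (norm_nonneg _).trans (hB 0)
  refine ⟨fun x => F x - movingAverage L F x,
    fun x => (hF x).sub (hasDerivAt_movingAverage_of_hasDerivAt hF hf L x), fun x => ?_⟩
  rw [norm_sub_rev]
  refine norm_movingAverage_sub_le hFc hL fun t ht => ?_
  calc ‖F t - F x‖ ≤ B * ‖t - x‖ :=
        convex_univ.norm_image_sub_le_of_norm_hasDerivWithin_le
          (fun y _ => (hF y).hasDerivWithinAt) (fun y _ => hB y) (Set.mem_univ x) (Set.mem_univ t)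
    _ ≤ B * L := by
        rw [Real.norm_of_nonneg (sub_nonneg.2 ht.1)]
        gcongr
        linarith [ht.2]

theorem hasBoundedDerivAndPrimitive_movingAverage (hf : Continuous f) (hB : ∀ x, ‖f x‖ ≤ B)
    {F : ℝ → E} (hF : ∀ x, HasDerivAt F (f x) x) {A : ℝ} (hA : ∀ x, ‖F x‖ ≤ A) {s : ℝ}
    (hs : 0 < s) : HasBoundedDerivAndPrimitive (movingAverage s f) := by
  have hderiv : deriv (movingAverage s f) = fun x => s⁻¹ • (f (x + s) - f x) :=
    funext fun x => (hasDerivAt_movingAverage hf s x).deriv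
  have hFc : Continuous F := continuous_iff_continuousAt.2 fun x => (hF x).continuousAt
  exact {
    contDiff := contDiff_one_iff_deriv.2
      ⟨fun x => (hasDerivAt_movingAverage hf s x).differentiableAt, by rw [hderiv]; fun_prop⟩
    exists_norm_le := ⟨B, norm_movingAverage_le hf hs hB⟩
    exists_norm_deriv_le := ⟨2 * B / s, fun x => by
      rw [hderiv]
      exact norm_inv_smul_sub_le hs (hB _) (hB _)⟩
    exists_primitive := ⟨movingAverage s F, hasDerivAt_movingAverage_of_hasDerivAt hF hf s, A,
      norm_movingAverage_le hFc hs hA⟩ }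

theorem exists_norm_sub_movingAverage_le (hf : UniformContinuous f) {ε : ℝ} (hε : 0 < ε) :
    ∃ s > 0, ∀ x, ‖f x - movingAverage s f x‖ ≤ ε := by
  obtain ⟨δ, hδ, hclose⟩ := Metric.uniformContinuous_iff.1 hf ε hε
  refine ⟨δ / 2, by positivity, fun x => ?_⟩
  rw [norm_sub_rev]
  refine norm_movingAverage_sub_le hf.continuous (by positivity) fun t ht => ?_
  rw [← dist_eq_norm]
  refine (hclose ?_).le
  rw [Real.dist_eq, abs_of_nonneg (sub_nonneg.2 ht.1)]
  linarith [ht.2]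

theorem exists_hasBoundedDerivAndPrimitive_approx (hf : UniformContinuous f) (hB : ∀ x, ‖f x‖ ≤ B)
    {ε L : ℝ} (hε : 0 < ε) (hL : 0 < L) (hmean : ∀ x, ‖movingAverage L f x‖ ≤ ε) :
    ∃ g : ℝ → E, HasBoundedDerivAndPrimitive g ∧ ∀ x, ‖f x - g x‖ ≤ 2 * ε := by
  have hfc := hf.continuous
  have hfL : Continuous (movingAverage L f) := continuous_movingAverage hfc L
  obtain ⟨s, hs, hfs⟩ := exists_norm_sub_movingAverage_le hf hε
  obtain ⟨K, hK, hKB⟩ := exists_bounded_primitive_sub_movingAverage hfc hB hL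
  have hbound : ∀ x, ‖f x - movingAverage L f x‖ ≤ B + ε := fun x =>
    norm_sub_le_of_le (hB x) (hmean x)
  refine ⟨movingAverage s fun x => f x - movingAverage L f x,
    hasBoundedDerivAndPrimitive_movingAverage (hfc.sub hfL) hbound hK hKB hs, fun x => ?_⟩
  rw [movingAverage_sub hfc hfL, ← sub_add]
  exact (norm_add_le_of_le (hfs x) (norm_movingAverage_le hfL hs hmean x)).trans (two_mul ε).ge

end RegularApproximation

/-- A sequence of scales is lacunary if it is nonzero and grows at least geometrically. The sequence
`α ^ n` with `|α| > 1` is the model case. -/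
def IsLacunary (c : ℕ → ℝ) : Prop :=
  c 0 ≠ 0 ∧ ∃ ρ > 1, ∀ n, ρ * |c n| ≤ |c (n + 1)|

theorem isLacunary_pow {α : ℝ} (hα : 1 < |α|) : IsLacunary fun n => α ^ n :=
  ⟨by simp, |α|, hα, fun n => by simp only [pow_succ', abs_mul, le_refl]⟩

theorem IsLacunary.exists_pow_mul_abs_le {c : ℕ → ℝ} (hc : IsLacunary c) :
    ∃ ρ > 1, ∀ m n, m ≤ n → ρ ^ (n - m) * |c m| ≤ |c n| := by
  obtain ⟨-, ρ, hρ, hgrow⟩ := hc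
  refine ⟨ρ, hρ, fun m n hmn => ?_⟩
  induction n, hmn using Nat.le_induction with
  | base => simp
  | succ n hmn ih =>
    calc ρ ^ (n + 1 - m) * |c m| = ρ * (ρ ^ (n - m) * |c m|) := by
          rw [Nat.sub_add_comm hmn, pow_succ']
          ring
      _ ≤ ρ * |c n| := by gcongr
      _ ≤ |c (n + 1)| := hgrow n

theorem ae_of_forall_ae_restrict_Ioc {p : ℝ → Prop}
    (h : ∀ a b : ℝ, a ≤ b → ∀ᵐ x ∂volume.restrict (Set.Ioc a b), p x) : ∀ᵐ x, p x := by
  rw [← Measure.restrict_univ (μ := volume), ← iUnion_Ioc_intCast ℝ, ae_restrict_iUnion_iff]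
  exact fun n => h n (n + 1) (by linarith)

section InnerProductSpace

variable {E : Type*} [NormedAddCommGroup E] [InnerProductSpace ℝ E]

theorem mul_integral_inner_comp_mul {U u v : ℝ → E} (hU : ∀ x, HasDerivAt U (u x) x)
    (hu : Continuous u) (hv : ContDiff ℝ 1 v) (p q a b : ℝ) :
    p * ∫ x in a..b, ⟪v (q * x), u (p * x)⟫ =
      ⟪v (q * b), U (p * b)⟫ - ⟪v (q * a), U (p * a)⟫ -
        q * ∫ x in a..b, ⟪deriv v (q * x), U (p * x)⟫ := by
  have hvc : Continuous v := hv.continuous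
  have : Continuous (deriv v) := hv.continuous_deriv_one
  have hUc : Continuous U := continuous_iff_continuousAt.2 fun x => (hU x).continuousAt
  have hderiv : ∀ x, HasDerivAt (fun x => ⟪v (q * x), U (p * x)⟫)
      (p * ⟪v (q * x), u (p * x)⟫ + q * ⟪deriv v (q * x), U (p * x)⟫) x := fun x => by
    have hvx := (hv.differentiable_one (q * x)).hasDerivAt.scomp x (hasDerivAt_const_mul q)
    simpa only [Function.comp_def, inner_smul_left, inner_smul_right, RCLike.conj_to_real] using
      hvx.inner ℝ ((hU (p * x)).scomp x (hasDerivAt_const_mul p))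
  have hmain : Continuous fun x => p * ⟪v (q * x), u (p * x)⟫ := by fun_prop
  have hrest : Continuous fun x => q * ⟪deriv v (q * x), U (p * x)⟫ := by fun_prop
  rw [← intervalIntegral.integral_eq_sub_of_hasDerivAt (fun x _ => hderiv x)
      ((hmain.add hrest).intervalIntegrable a b),
    intervalIntegral.integral_add (hmain.intervalIntegrable a b) (hrest.intervalIntegrable a b),
    intervalIntegral.integral_const_mul, intervalIntegral.integral_const_mul, add_sub_cancel_right]

theorem abs_integral_inner_comp_mul_le {U u v : ℝ → E} (hU : ∀ x, HasDerivAt U (u x) x)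
    (hu : Continuous u) (hv : ContDiff ℝ 1 v) {A B D : ℝ} (hUA : ∀ x, ‖U x‖ ≤ A)
    (hvB : ∀ x, ‖v x‖ ≤ B) (hvD : ∀ x, ‖deriv v x‖ ≤ D) {p : ℝ} (hp : p ≠ 0) (q : ℝ)
    {a b : ℝ} (hab : a ≤ b) :
    |∫ x in a..b, ⟪v (q * x), u (p * x)⟫| ≤ A * (2 * B + D * |q| * (b - a)) / |p| := by
  have hinner : ∀ {C : ℝ} {w : ℝ → E}, (∀ x, ‖w x‖ ≤ C) → ∀ x y, |⟪w x, U y⟫| ≤ A * C :=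
    fun hw x y => (abs_real_inner_le_norm _ _).trans <| by
      rw [mul_comm A]
      exact mul_le_mul (hw x) (hUA y) (norm_nonneg _) ((norm_nonneg _).trans (hw x))
  have hint : |∫ x in a..b, ⟪deriv v (q * x), U (p * x)⟫| ≤ A * D * (b - a) := by
    rw [← Real.norm_eq_abs, ← abs_of_nonneg (sub_nonneg.2 hab)]
    exact intervalIntegral.norm_integral_le_of_norm_le_const fun x _ => hinner hvD (q * x) (p * x)
  rw [le_div_iff₀' (abs_pos.2 hp), ← abs_mul, mul_integral_inner_comp_mul hU hu hv]
  calc _ ≤ |⟪v (q * b), U (p * b)⟫| + |⟪v (q * a), U (p * a)⟫| +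
        |q| * |∫ x in a..b, ⟪deriv v (q * x), U (p * x)⟫| := by
        rw [← abs_mul]
        exact (abs_sub _ _).trans (by gcongr; exact abs_sub _ _)
    _ ≤ A * B + A * B + |q| * (A * D * (b - a)) := by
        gcongr
        exacts [hinner hvB _ _, hinner hvB _ _]
    _ = A * (2 * B + D * |q| * (b - a)) := by ring

namespace HasBoundedDerivAndPrimitive

variable {g : ℝ → E} {c : ℕ → ℝ}

theorem exists_summable_correlation_bound (hg : HasBoundedDerivAndPrimitive g)
    (hc : IsLacunary c) {a b : ℝ} (hab : a ≤ b) :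
    ∃ r : ℕ → ℝ, Summable r ∧
      ∀ m n, m ≤ n → |∫ x in a..b, ⟪g (c m * x), g (c n * x)⟫| ≤ r (n - m) := by
  obtain ⟨B, hB⟩ := hg.exists_norm_le
  obtain ⟨D, hD⟩ := hg.exists_norm_deriv_le
  obtain ⟨G, hG, A, hA⟩ := hg.exists_primitive
  obtain ⟨ρ, hρ, hgrow⟩ := hc.exists_pow_mul_abs_le
  have hA0 : 0 ≤ A := (norm_nonneg _).trans (hA 0)
  have hB0 : 0 ≤ B := (norm_nonneg _).trans (hB 0)
  have hD0 : 0 ≤ D := (norm_nonneg _).trans (hD 0)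
  have : 0 ≤ b - a := sub_nonneg.2 hab
  have hc0 : 0 < |c 0| := abs_pos.2 hc.1
  have hc0_le : ∀ n, |c 0| ≤ |c n| := fun n =>
    (le_mul_of_one_le_left hc0.le (one_le_pow₀ hρ.le)).trans (hgrow 0 n n.zero_le)
  refine ⟨fun k => A * (2 * B / |c 0| + D * (b - a)) * ρ⁻¹ ^ k,
    (summable_geometric_of_lt_one (by positivity) (inv_lt_one_of_one_lt₀ hρ)).mul_left _,
    fun m n hmn => ?_⟩
  have hcm : 0 < |c m| := hc0.trans_le (hc0_le m)
  have hcn : 0 < |c n| := hc0.trans_le (hc0_le n)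
  calc _ ≤ A * (2 * B + D * |c m| * (b - a)) / |c n| :=
        abs_integral_inner_comp_mul_le hG hg.contDiff.continuous hg.contDiff hA hB hD
          (abs_pos.1 hcn) (c m) hab
    _ = A * (2 * B / |c m| + D * (b - a)) * (|c m| / |c n|) := by field_simp
    _ ≤ A * (2 * B / |c 0| + D * (b - a)) * ρ⁻¹ ^ (n - m) := by
        have hinv : 2 * B / |c m| ≤ 2 * B / |c 0| :=
          div_le_div_of_nonneg_left (by positivity) hc0 (hc0_le m)
        have hratio : |c m| / |c n| ≤ ρ⁻¹ ^ (n - m) := by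
          rw [inv_pow, div_le_iff₀ hcn, inv_mul_eq_div, le_div_iff₀' (by positivity)]
          exact hgrow m n hmn
        gcongr

theorem ae_tendsto_cesaroMean_zero (hg : HasBoundedDerivAndPrimitive g) (hc : IsLacunary c) :
    ∀ᵐ x : ℝ, Tendsto (cesaroMean fun n => g (c n * x)) atTop (𝓝 0) := by
  obtain ⟨B, hB⟩ := hg.exists_norm_le
  have hgc : Continuous g := hg.contDiff.continuous
  refine ae_of_forall_ae_restrict_Ioc fun a b hab => ?_
  obtain ⟨r, hr, hcorr⟩ := hg.exists_summable_correlation_bound hc hab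
  simp only [intervalIntegral.integral_of_le hab] at hcorr
  have hinner : ∀ m n, Continuous fun x => ⟪g (c m * x), g (c n * x)⟫ := fun m n => by fun_prop
  exact ae_tendsto_cesaroMean_zero_of_correlation_le (fun n x => hB (c n * x))
    (fun m n => (hinner m n).integrableOn_Ioc) hr hcorr

end HasBoundedDerivAndPrimitive

theorem ae_tendsto_cesaroMean_of_tendstoUniformly_movingAverage [CompleteSpace E]
    {c : ℕ → ℝ} (hc : IsLacunary c) {f : ℝ → E} (hf : UniformContinuous f) {B : ℝ}
    (hB : ∀ x, ‖f x‖ ≤ B) {M : E}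
    (hM : TendstoUniformly (fun T => movingAverage T f) (fun _ => M) atTop) :
    ∀ᵐ x : ℝ, Tendsto (cesaroMean fun n => f (c n * x)) atTop (𝓝 M) := by
  have hcentred : ∀ᵐ x : ℝ, Tendsto (cesaroMean fun n => f (c n * x) - M) atTop (𝓝 0) := by
    refine ae_tendsto_cesaroMean_zero_of_approx fun ε hε => ?_
    have hsmall := Metric.tendstoUniformly_iff.1 hM (ε / 2) (by positivity)
    obtain ⟨L, hLM, hL⟩ := (hsmall.and (eventually_gt_atTop 0)).exists
    obtain ⟨g, hg, hfg⟩ := exists_hasBoundedDerivAndPrimitive_approx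
      (hf.sub uniformContinuous_const) (fun x => norm_sub_le_of_le (hB x) le_rfl)
      (half_pos hε) hL fun x => by
        rw [movingAverage_sub_const hf.continuous hL, ← dist_eq_norm']
        exact (hLM x).le
    exact ⟨fun n x => g (c n * x), fun n x => (hfg _).trans (by linarith),
      hg.ae_tendsto_cesaroMean_zero hc⟩
  filter_upwards [hcentred] with x hx
  have hconst : Tendsto (cesaroMean fun _ => M) atTop (𝓝 M) :=
    (tendsto_const_nhds (x := M)).cesaro_smul
  simpa [cesaroMean_sub] using hx.add hconst

end InnerProductSpace

theorem mainTheorem1_general (c : ℕ → ℝ) (hc : IsLacunary c) (f : ℝ → ℂ)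
    (hf : IsBohrAlmostPeriodic f) :
    ∃ M : ℂ, HasMean f M ∧
      ∀ᵐ x : ℝ, Tendsto (fun N : ℕ => (1 / (N : ℂ)) * ∑ n ∈ Finset.range N, f (c n * x))
        atTop (𝓝 M) := by
  obtain ⟨M, hM⟩ :=
    exists_tendstoUniformly_movingAverage hf.1 hf.tendstoUniformly_movingAverage_sub
  obtain ⟨B, hB⟩ := hf.exists_norm_le
  refine ⟨M, hasMean_of_tendstoUniformly_movingAverage hM, ?_⟩
  filter_upwards [ae_tendsto_cesaroMean_of_tendstoUniformly_movingAverage hc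
    hf.uniformContinuous hB hM] with x hx
  refine hx.congr fun N => ?_
  rw [cesaroMean, Complex.real_smul, Complex.ofReal_inv, Complex.ofReal_natCast, one_div]

theorem mainTheorem1 (α : ℝ) (hα : 1 < |α|) (f : ℝ → ℂ) (hf : IsBohrAlmostPeriodic f) :
    ∃ M : ℂ, HasMean f M ∧
      ∀ᵐ x : ℝ, Tendsto (fun N : ℕ => (1 / (N : ℂ)) * ∑ n ∈ Finset.range N, f (α ^ n * x))
        atTop (𝓝 M) :=
  mainTheorem1_general _ (isLacunary_pow hα) f hf
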